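/- **Conventions.** A *tree* is a partially ordered set $(T,\preceq)$ such that for every $a\in T$ the set $\{b\in T: b\prec a\}$ is finite and linearly ordered; its cardinality $\ell(a)$ is the *level* of $a$. Write $T(n)=\{a:\ell(a)=n\}$, $T({<}n)=\{a:\ell(a)<n\}$, $T({\le}n)=\{a:\ell(a)\le n\}$, $\omega=\{0,1,2,\dots\}$, and let $T^{<\omega}$ be the set of finite sequences in $T$. An *$\mathcal S$-tree* is a quadruple $(T,\preceq,\Sigma,\mathcal S)$, where $(T,\preceq)$ is a countable finitely branching tree with finitely many nodes of level $0$, $\Sigma$ is a set, and $\mathcal S$ is a partial function $T\times T^{<\omega}\times\Sigma\to T$ such that (S1) if $\mathcal S(a,\bar p,c)$ is defined, then it is an immediate successor of $a$, and all nodes in $\bar p$ have level at most $\ell(a)-1$; (S2) if $\mathcal S(a,\bar p,c)=\mathcal S(b,\bar q,d)$, both sides being defined, then $a=b$, $\bar p=\bar q$, $c=d$; (S3) for every $a\in T$ and every immediate successor $b$ of $a$ there are $\bar p$ and $c$ with $b=\mathcal S(a,\bar p,c)$. An injection $F\colon T\to T$ is *shape-preserving* if (i) $\ell(a)=\ell(b)$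 implies $\ell(F(a))=\ell(F(b))$; (ii) whenever $\mathcal S(a,\bar p,c)$ is defined, $\mathcal S(F(a),F(\bar p),c)$ is defined and $\mathcal S(F(a),F(\bar p),c)\preceq F(\mathcal S(a,\bar p,c))$, where $F(\bar p)$ is the tuple of images of the entries of $\bar p$; (iii) for all $a\in T(0)$ and $b\in T$ with $a\preceq b$ also $a\preceq F(b)$. For such $F$ let $\tilde F(n)=\ell(F(a))$ for any $a\in T(n)$; so $\tilde F$ is defined at the $n$ with $T(n)\ne\emptyset$. $F$ *skips* level $m$ if $m$ is not a value of $\tilde F$, and *skips only* level $m$ if the set of values of $\tilde F$ is exactly $\omega\setminus\{m\}$. An *$(\mathcal S,\mathcal M)$-tree* $(T,\preceq,\Sigma,\mathcal S,\mathcal M)$ is an $\mathcal S$-tree together with a set $\mathcal M$ of shape-preserving functions $T\to T$ such that (M1) $\mathrm{Id}\in\mathcal M$, $\mathcal M$ is closed under composition, and for every sequence $(F_i)_{i\in\omega}$ in $\mathcal M$ with $F_i\restriction_{T(\le i)}=F_{i+1}\restriction_{T(\le i)}$ for all $i$ there is $F_\infty\in\mathcal M$ with $F_\infty\restriction_{T(\le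 i)}=F_i\restriction_{T(\le i)}$ for all $i$; (M2) for every $n\in\omega$ and every $F\in\mathcal M$ with $\tilde F(n)>0$ that skips level $\tilde F(n)-1$ there are $F_1,F_2\in\mathcal M$ such that $F_2$ skips only level $\tilde F(n)-1$ and $F_2\circ F_1\restriction_{T(\le n)}=F\restriction_{T(\le n)}$; (M3) for all $n<m$ in $\omega$ there is $F^n_m\in\mathcal M$ skipping only level $m$ such that $F^n_m(b)=\mathcal S(b,\bar p,c)$ (in particular, the right side is defined) for all $a\in T(n)$, $b\in T(m)$, $\bar p\in T^{<\omega}$, $c\in\Sigma$ for which $\mathcal S(a,\bar p,c)$ is defined and $\mathcal S(a,\bar p,c)\preceq b$. For $n,k\in\omega$ put $\mathcal M^n=\{F\in\mathcal M: F\restriction_{T(<n)}\text{ is the identity}\}$ and $\mathcal{AM}^n_k=\{F\restriction_{T(<n+k)}: F\in\mathcal M^n\}$. **Theorem.** Let $(T,\preceq,\Sigma,\mathcal S,\mathcal M)$ be an $(\mathcal S,\mathcal M)$-tree. Then for all $n,k\in\omega$ and every colouring $\chi\colon\mathcal{AM}^n_k\to C$ with $C$ a finite set, there exists $F\in\mathcal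 M^n$ such that $\chi$ is constant on $\{F\circ g: g\in\mathcal{AM}^n_k\}$. -/

import Mathlib

universe u v w

namespace ShapeRamsey

/-- The level `ℓ(a) = |{b : b < a}|` of a node. In a tree all these sets are finite. -/
noncomputable def level {T : Type u} [PartialOrder T] (a : T) : ℕ :=
  (Set.Iio a).ncard

/-- An `𝒮`-tree `(T, ≤, A, 𝒮)`: a countable finitely branching tree `(T, ≤)` with finitely many
nodes of level `0`, an alphabet `A`, and a partial successor operation
`𝒮 : T × T^{<ω} × A → T` (undefined values are `none`) satisfying (S1), (S2), (S3). -/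
structure STree (T : Type u) [PartialOrder T] (A : Type v) where
  /-- strict predecessors of a node are finite in number -/
  finite_Iio : ∀ a : T, (Set.Iio a).Finite
  /-- strict predecessors of a node are linearly ordered -/
  isChain_Iio : ∀ a : T, IsChain (· ≤ ·) (Set.Iio a)
  countable : Countable T
  /-- the tree is finitely branching -/
  finite_covers : ∀ a : T, {b : T | a ⋖ b}.Finite
  finite_roots : {a : T | level a = 0}.Finite
  /-- the successor operation -/
  succOp : T → List T → A → Option T
  /-- (S1), first part -/
  covBy_of_succOp : ∀ a p c b, succOp a p c = some b → a ⋖ b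
  /-- (S1), second part: parameters have levels at most `ℓ(a) - 1`
  (the subtraction being that of the integers) -/
  level_param_lt : ∀ a p c b, succOp a p c = some b → ∀ q ∈ p, level q < level a
  /-- (S2) injectivity -/
  succOp_inj : ∀ a p c b q d x, succOp a p c = some x → succOp b q d = some x →
    a = b ∧ p = q ∧ c = d
  /-- (S3) constructivity -/
  exists_succOp : ∀ a b : T, a ⋖ b → ∃ p c, succOp a p c = some b

variable {T : Type u} [PartialOrder T] {A : Type v}

/-- Shape-preserving functions `T → T` of an `𝒮`-tree. -/
structure IsShapePreserving (S : STree T A) (F : T → T) : Prop where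
  injective : Function.Injective F
  /-- `F` is level preserving -/
  level_eq : ∀ a b : T, level a = level b → level (F a) = level (F b)
  /-- `F` is weakly `𝒮`-preserving; `p.map F` is the tuple of images of the entries of `p` -/
  succOp_le : ∀ a p c b, S.succOp a p c = some b →
    ∃ x, S.succOp (F a) (p.map F) c = some x ∧ x ≤ F b
  root_le : ∀ a b : T, level a = 0 → a ≤ b → a ≤ F b

/-- The graph of the level function of a level-preserving `F`: `F` maps level `i` into
level `j`. -/
def MapsLevel (F : T → T) (i j : ℕ) : Prop :=
  ∃ a : T, level a = i ∧ level (F a) = j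

/-- `F` skips level `m`: no level is mapped into level `m`. -/
def Skips (F : T → T) (m : ℕ) : Prop :=
  ¬ ∃ i, MapsLevel F i m

/-- `F` skips only level `m`: the set of levels `j` into which some level is mapped is exactly
`ω \ {m}`. -/
def SkipsOnly (F : T → T) (m : ℕ) : Prop :=
  {j : ℕ | ∃ i, MapsLevel F i j} = {m}ᶜ

/-- `(T, ≤, A, 𝒮, M)` is an `(𝒮, ℳ)`-tree. -/
structure IsSMTree (S : STree T A) (M : Set (T → T)) : Prop where
  shapePreserving : ∀ F ∈ M, IsShapePreserving S F
  /-- (M1) `M` is a monoid ... -/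
  id_mem : (id : T → T) ∈ M
  comp_mem : ∀ F ∈ M, ∀ G ∈ M, F ∘ G ∈ M
  /-- ... which is closed under limits -/
  limit_mem : ∀ f : ℕ → T → T, (∀ i, f i ∈ M) →
    (∀ i, ∀ a : T, level a ≤ i → f i a = f (i + 1) a) →
    ∃ G ∈ M, ∀ i, ∀ a : T, level a ≤ i → G a = f i a
  /-- (M2) `M` admits decompositions; here `m + 1` is the level into which `F` maps level `n` -/
  decomposition : ∀ (n m : ℕ), ∀ F ∈ M, MapsLevel F n (m + 1) → Skips F m →
    ∃ F₁ ∈ M, ∃ F₂ ∈ M, SkipsOnly F₂ m ∧ ∀ a : T, level a ≤ n → F₂ (F₁ a) = F a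
  /-- (M3) `M` is closed for duplication -/
  duplication : ∀ n m : ℕ, n < m → ∃ F ∈ M, SkipsOnly F m ∧
    ∀ (a b : T) (p : List T) (c : A) (x : T), level a = n → level b = m →
      S.succOp a p c = some x → x ≤ b → S.succOp b p c = some (F b)

/-- `ℳ^n`: the members of `M` which are the identity on `T(<n)`. -/
def fixing (M : Set (T → T)) (n : ℕ) : Set (T → T) :=
  {F | F ∈ M ∧ ∀ a : T, level a < n → F a = a}

/-- `𝒜ℳ^n_k`: the restrictions to `T(<n+k)` of members of `ℳ^n`. -/
def approx (M : Set (T → T)) (n k : ℕ) : Set ({a : T | level a < n + k} → T) :=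
  {f | ∃ F ∈ fixing M n, f = fun a => F a.1}

/-- If `F ∈ ℳ^n` and `g ∈ 𝒜ℳ^n_k`, then `F ∘ g ∈ 𝒜ℳ^n_k`. -/
theorem IsSMTree.comp_mem_approx {S : STree T A} {M : Set (T → T)} (h : IsSMTree S M)
    {n k : ℕ} {F : T → T} (hF : F ∈ fixing M n)
    {g : {a : T | level a < n + k} → T} (hg : g ∈ approx M n k) : F ∘ g ∈ approx M n k := by
  obtain ⟨G, hG, rfl⟩ := hg
  refine ⟨F ∘ G, ⟨h.comp_mem F hF.1 G hG.1, fun a ha => ?_⟩, rfl⟩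
  simp [hG.2 a ha, hF.2 a ha]

end ShapeRamsey

/-! ### Trees and agreement of functions on initial segments. -/

namespace ShapeRamsey
variable {T : Type u} [PartialOrder T] {A : Type v}

/-! Members of `M` behave like words. A letter at `N` is a member of ℳ^N sending level `N` to `N +
1`. By (M2), members of ℳ^n are on T(≤n) products of letters at successive levels
(`exists_letter_comp`), and letters can be moved past other members (`exists_letter_comm`). By (M3),
a word can be extended by a copy of an earlier letter, so substituting a letter into a variable word
becomes composing with a fixed `H` (`exists_variable_word`).

The combinatorial core is a left-variable form of the Hales–Jewett theorem
(`hasLeftLine_of_finite`). It gives an `H` whose colour is unchanged by composition with letters on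
the right (`exists_letter_invariant`).

For `k = 1`, some colour is large, meeting every subspace of a suitable subspace. A large property
can be realised so that it stays large above all letters at once (`exists_large_step`); iterating
and taking limits makes it hold on a whole subspace (`exists_forall_of_large`).

For general `k`, fusing the case `k = 1` makes the colour independent of where the last level goes.
Since a level sent as low as possible is determined by the levels below it (`agree_succ`), the
colour then depends on one level less, and induction applies. -/

/-- `F` and `G` coincide on `T(<m)`. -/
def Agree (m : ℕ) (F G : T → T) : Prop := ∀ a : T, level a < m → F a = G a

theorem Agree.symm {m : ℕ} {F G : T → T} (h : Agree m F G) : Agree m G F :=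
  fun a ha => (h a ha).symm

theorem Agree.trans {m : ℕ} {F G H : T → T} (h : Agree m F G) (h' : Agree m G H) : Agree m F H :=
  fun a ha => (h a ha).trans (h' a ha)

theorem Agree.mono {m n : ℕ} {F G : T → T} (h : Agree n F G) (hmn : m ≤ n) : Agree m F G :=
  fun a ha => h a (ha.trans_le hmn)

theorem Agree.comp_left {m : ℕ} {F G : T → T} (h : Agree m F G) (K : T → T) :
    Agree m (K ∘ F) (K ∘ G) :=
  fun a ha => congrArg K (h a ha)

/-- The level into which a level-preserving `F` maps level `i`. -/
noncomputable def lev (F : T → T) (i : ℕ) : ℕ := sInf {j | MapsLevel F i j}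

namespace STree
variable (S : STree T A)
include S

theorem level_lt {a b : T} (h : a < b) : level a < level b := by
  refine Set.ncard_lt_ncard ?_ (S.finite_Iio b)
  exact ⟨fun x hx => lt_trans hx h, fun hs => lt_irrefl a (hs h)⟩

theorem eq_of_le {a b : T} (h : a ≤ b) (hl : level b ≤ level a) : a = b := by
  rcases h.eq_or_lt with h | h
  · exact h
  · exact absurd (S.level_lt h) hl.not_gt

theorem le_or_le {a b x : T} (ha : a ≤ x) (hb : b ≤ x) : a ≤ b ∨ b ≤ a := by
  rcases ha.eq_or_lt with rfl | ha
  · exact Or.inr hb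
  rcases hb.eq_or_lt with rfl | hb
  · exact Or.inl ha.le
  by_cases hab : a = b
  · exact Or.inl hab.le
  exact S.isChain_Iio x ha hb hab

theorem eq_of_le_of_le {a b x : T} (ha : a ≤ x) (hb : b ≤ x) (h : level a = level b) : a = b := by
  rcases S.le_or_le ha hb with h' | h'
  · exact S.eq_of_le h' h.ge
  · exact (S.eq_of_le h' h.le).symm

theorem level_covBy {a b : T} (h : a ⋖ b) : level b = level a + 1 := by
  have : Set.Iio b = insert a (Set.Iio a) := by
    ext x
    simp only [Set.mem_Iio, Set.mem_insert_iff]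
    constructor
    · intro hx
      rcases S.le_or_le hx.le h.1.le with h' | h'
      · exact h'.eq_or_lt
      · rcases h'.eq_or_lt with h' | h'
        · exact Or.inl h'.symm
        · exact absurd hx (h.2 h')
    · rintro (rfl | hx)
      · exact h.1
      · exact hx.trans h.1
  unfold level
  rw [this, Set.ncard_insert_of_notMem (by simp) (S.finite_Iio a)]

theorem covBy_of_lt {a b : T} (h : a < b) (hl : level b = level a + 1) : a ⋖ b := by
  refine ⟨h, fun c hac hcb => ?_⟩
  have := S.level_lt hac
  have := S.level_lt hcb
  omega

theorem exists_covBy_of_lt {a b : T} (h : a < b) : ∃ c, a ≤ c ∧ c ⋖ b := by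
  have hfin : (Set.Iio b ∩ Set.Ici a).Finite := (S.finite_Iio b).subset Set.inter_subset_left
  obtain ⟨c, hc⟩ := hfin.exists_maximal ⟨a, h, le_rfl⟩
  refine ⟨c, hc.1.2, hc.1.1, fun x hcx hxb => ?_⟩
  exact absurd (hc.2 ⟨hxb, hc.1.2.trans hcx.le⟩ hcx.le) hcx.not_ge

theorem exists_covBy {b : T} (h : 0 < level b) : ∃ c, c ⋖ b := by
  have : (Set.Iio b).Nonempty := by
    rw [← Set.ncard_pos (S.finite_Iio b)]; exact h
  obtain ⟨a, ha⟩ := this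
  obtain ⟨c, -, hc⟩ := S.exists_covBy_of_lt ha
  exact ⟨c, hc⟩

theorem finite_level_eq (m : ℕ) : {a : T | level a = m}.Finite := by
  induction m with
  | zero => exact S.finite_roots
  | succ m ih =>
    refine (ih.biUnion fun a _ => S.finite_covers a).subset fun b hb => ?_
    obtain ⟨c, hc⟩ := S.exists_covBy (b := b) (by rw [hb]; omega)
    have := S.level_covBy hc
    have hb' : level b = m + 1 := hb
    simp only [Set.mem_iUnion]
    exact ⟨c, by show level c = m; omega, hc⟩

theorem finite_level_lt (m : ℕ) : {a : T | level a < m}.Finite := by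
  refine ((Set.finite_Iio m).biUnion fun i _ => S.finite_level_eq i).subset fun a ha => ?_
  simp only [Set.mem_iUnion]
  exact ⟨level a, ha, rfl⟩

/-- Up to agreement on `T(<m)`, there are finitely many functions mapping `T(<m)` to `T(<B)`. -/
theorem exists_finite_reps (m B : ℕ) (s : Set (T → T))
    (hs : ∀ F ∈ s, ∀ a, level a < m → level (F a) < B) :
    ∃ t ⊆ s, t.Finite ∧ ∀ F ∈ s, ∃ G ∈ t, Agree m F G := by
  have : Finite {a : T | level a < m} := S.finite_level_lt m
  have : Finite {a : T | level a < B} := S.finite_level_lt B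
  let r : (T → T) → ({a : T | level a < m} → T) := fun F a => F a
  have hfin : (r '' s).Finite := by
    refine (Set.finite_range
      (fun (f : {a : T | level a < m} → {a : T | level a < B}) a => (f a : T))).subset ?_
    rintro _ ⟨F, hF, rfl⟩
    exact ⟨fun a => ⟨F a, hs F hF a a.2⟩, rfl⟩
  obtain ⟨t, hts, ht⟩ := s.exists_subset_bijOn r
  refine ⟨t, hts, ht.finite_iff_finite.2 hfin, fun F hF => ?_⟩
  obtain ⟨G, hG, hGF⟩ := ht.surjOn ⟨F, hF, rfl⟩
  exact ⟨G, hG, fun a ha => (congrFun hGF ⟨a, ha⟩).symm⟩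

end STree
end ShapeRamsey

/-! ### Left-variable Hales–Jewett theorem. -/

namespace ShapeRamsey

/-- A colouring of words has a monochromatic left line: a word `u` and a variable word starting
with its variable such that `u` and all words obtained by appending to `u` an instance of the
variable word have the same colour. -/
def HasLeftLine {α : Type u} {C : Type w} (c : List α → C) : Prop :=
  ∃ (f : List α) (v : List (Option α)), ∀ i, c f = c (f ++ i :: v.map (·.getD i))

theorem exists_split_of_none_mem {α : Type u} (v : List (Option α)) (h : none ∈ v) :
    ∃ (f : List α) (v' : List (Option α)), v = f.map some ++ none :: v' := by
  induction v with
  | nil => simp at h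
  | cons o v ih =>
    cases o with
    | none => exact ⟨[], v, rfl⟩
    | some j =>
      obtain ⟨f, v', rfl⟩ := ih (by simpa using h)
      exact ⟨j :: f, v', rfl⟩

theorem HasLeftLine.of_append {α : Type u} {C : Type w} {c : List α → C} (g : List α)
    (h : HasLeftLine fun f => c (g ++ f)) : HasLeftLine c := by
  obtain ⟨f, v, h⟩ := h
  exact ⟨g ++ f, v, fun i => by simpa using h i⟩

/-- Apply Hales–Jewett with the pattern of colours over all suffixes `g` of length at most `N` as
colour. This gives a variable word V = f·x·v for which the colour of V(i)·g does not depend on `i`.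
If it equalled the colour of `f`, then `f` and x·v·g would form a left line; so `f` has a colour
beyond the `k` found among the V(i₀)·g. -/
theorem exists_le_ncard_of_not_hasLeftLine (α : Type u) [Finite α] [Nonempty α] (C : Type w)
    [Finite C] (k : ℕ) :
    ∃ N, ∀ c : List α → C, ¬ HasLeftLine c → k ≤ (c '' {f | f.length ≤ N}).ncard := by
  induction k with
  | zero => exact ⟨0, fun _ _ => Nat.zero_le _⟩
  | succ k ih =>
    obtain ⟨N, hN⟩ := ih
    have : Finite {f : List α // f.length ≤ N} := List.finite_length_le α N
    obtain ⟨ι, hι, hHJ⟩ := Combinatorics.Line.exists_mono_in_high_dimension α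
      ({f : List α // f.length ≤ N} → C)
    let e := Fintype.equivFin ι
    refine ⟨Fintype.card ι + N, fun c hc => ?_⟩
    obtain ⟨l, d, hl⟩ := hHJ fun x f => c (List.ofFn (x ∘ e.symm) ++ f)
    let V : List (Option α) := List.ofFn (l.idxFun ∘ e.symm)
    have hV : ∀ i, List.ofFn (l i ∘ e.symm) = V.map (·.getD i) := by
      intro i
      simp only [V, List.map_ofFn]
      rfl
    have hnone : none ∈ V := by
      obtain ⟨i, hi⟩ := l.proper
      exact List.mem_ofFn.2 ⟨e i, by simp [hi]⟩
    have hlen : V.length = Fintype.card ι := by simp [V]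
    obtain ⟨f, v, hfv⟩ := exists_split_of_none_mem V hnone
    have hVi : ∀ i, V.map (·.getD i) = f ++ i :: v.map (·.getD i) := by
      intro i
      rw [hfv]; simp [Function.comp_def]
    have hmono : ∀ i j, ∀ g : List α, g.length ≤ N →
        c (V.map (·.getD i) ++ g) = c (V.map (·.getD j) ++ g) := by
      intro i j g hg
      have h1 := congrFun (hl i) ⟨g, hg⟩
      have h2 := congrFun (hl j) ⟨g, hg⟩
      simp only [hV] at h1 h2
      rw [h1, h2]
    obtain ⟨i₀⟩ := ‹Nonempty α›
    have hk := hN (fun g => c (V.map (·.getD i₀) ++ g)) fun h => hc (h.of_append _)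
    have hnot : c f ∉ (fun g => c (V.map (·.getD i₀) ++ g)) '' {f | f.length ≤ N} := by
      rintro ⟨g, hg, hgf⟩
      refine hc ⟨f, v ++ g.map some, fun i => ?_⟩
      rw [← hgf]
      show c (V.map (·.getD i₀) ++ g) = _
      rw [hmono i₀ i g hg, hVi i]
      simp [Function.comp_def]
    calc k + 1 ≤ ((fun g => c (V.map (·.getD i₀) ++ g)) '' {f | f.length ≤ N}).ncard + 1 := by
          omega
      _ = (insert (c f) ((fun g => c (V.map (·.getD i₀) ++ g)) '' {f | f.length ≤ N})).ncard :=
          (Set.ncard_insert_of_notMem hnot).symm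
      _ ≤ _ := by
          refine Set.ncard_le_ncard ?_
          rintro _ (rfl | ⟨g, hg, rfl⟩)
          · refine ⟨f, ?_, rfl⟩
            have := congrArg List.length hfv
            simp at this
            simp only [Set.mem_ofPred_eq]
            omega
          · refine ⟨V.map (·.getD i₀) ++ g, ?_, rfl⟩
            simp only [Set.mem_ofPred_eq, List.length_append, List.length_map] at hg ⊢
            omega

theorem hasLeftLine_of_finite {α : Type u} [Finite α] {C : Type w} [Finite C] (c : List α → C) :
    HasLeftLine c := by
  rcases isEmpty_or_nonempty α with h | h
  · exact ⟨[], [], fun i => h.elim i⟩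
  by_contra hc
  obtain ⟨N, hN⟩ := exists_le_ncard_of_not_hasLeftLine α C (Nat.card C + 1)
  have h1 := hN c hc
  have h2 := Set.ncard_le_card (c '' {f | f.length ≤ N})
  omega

end ShapeRamsey

/-! ### Level functions and rigidity of members of `M`. -/

namespace ShapeRamsey
variable {T : Type u} [PartialOrder T] {A : Type v}

namespace IsSMTree
variable {S : STree T A} {M : Set (T → T)} (hM : IsSMTree S M)
include hM

/-- (M3) provides a function skipping only level `k + 1`, so its values reach level `k`. -/
theorem exists_level_eq (k : ℕ) : ∃ a : T, level a = k := by
  obtain ⟨F, -, hF, -⟩ := hM.duplication 0 (k + 1) (by omega)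
  have : k ∈ {j : ℕ | ∃ i, MapsLevel F i j} := by rw [hF]; simp
  obtain ⟨-, a, -, ha⟩ := this
  exact ⟨F a, ha⟩

theorem level_apply {F : T → T} (hF : F ∈ M) (a : T) : level (F a) = lev F (level a) := by
  have : {j | MapsLevel F (level a) j} = {level (F a)} := by
    ext j
    constructor
    · rintro ⟨b, hb, rfl⟩
      exact (hM.shapePreserving F hF).level_eq b a hb
    · rintro rfl
      exact ⟨a, rfl, rfl⟩
  rw [lev, this, csInf_singleton]

theorem mapsLevel_iff {F : T → T} (hF : F ∈ M) {i j : ℕ} : MapsLevel F i j ↔ lev F i = j := by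
  constructor
  · rintro ⟨a, rfl, rfl⟩
    exact (hM.level_apply hF a).symm
  · rintro rfl
    obtain ⟨a, rfl⟩ := hM.exists_level_eq i
    exact ⟨a, rfl, hM.level_apply hF a⟩

theorem lev_comp {F G : T → T} (hF : F ∈ M) (hG : G ∈ M) (i : ℕ) :
    lev (F ∘ G) i = lev F (lev G i) := by
  obtain ⟨a, rfl⟩ := hM.exists_level_eq i
  rw [← hM.level_apply (hM.comp_mem F hF G hG), ← hM.level_apply hG, ← hM.level_apply hF,
    Function.comp_apply]

theorem lev_id (i : ℕ) : lev (id : T → T) i = i := by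
  obtain ⟨a, rfl⟩ := hM.exists_level_eq i
  exact (hM.level_apply hM.id_mem a).symm

theorem lev_congr {F G : T → T} (hF : F ∈ M) (hG : G ∈ M) {m i : ℕ} (h : Agree m F G)
    (hi : i < m) : lev F i = lev G i := by
  obtain ⟨a, rfl⟩ := hM.exists_level_eq i
  rw [← hM.level_apply hF, ← hM.level_apply hG, h a hi]

theorem apply_lt_of_covBy {F : T → T} (hF : F ∈ M) {a b : T} (h : a ⋖ b) : F a < F b := by
  obtain ⟨p, c, hp⟩ := S.exists_succOp a b h
  obtain ⟨x, hx, hxb⟩ := (hM.shapePreserving F hF).succOp_le a p c b hp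
  exact (S.covBy_of_succOp _ _ _ _ hx).1.trans_le hxb

theorem monotone {F : T → T} (hF : F ∈ M) : Monotone F := by
  have : ∀ k, ∀ a b : T, level b = k → a ≤ b → F a ≤ F b := by
    intro k
    induction k with
    | zero =>
      intro a b hb hab
      rw [S.eq_of_le hab (by omega)]
    | succ k ih =>
      intro a b hb hab
      rcases hab.eq_or_lt with rfl | hab
      · exact le_rfl
      obtain ⟨c, hac, hcb⟩ := S.exists_covBy_of_lt hab
      have := S.level_covBy hcb
      exact (ih a c (by omega) hac).trans (hM.apply_lt_of_covBy hF hcb).le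
  exact fun a b => this _ a b rfl

theorem lev_strictMono {F : T → T} (hF : F ∈ M) : StrictMono (lev F) := by
  refine strictMono_nat_of_lt_succ fun i => ?_
  obtain ⟨b, hb⟩ := hM.exists_level_eq (i + 1)
  obtain ⟨a, ha⟩ := S.exists_covBy (b := b) (by omega)
  have := S.level_covBy ha
  rw [← hb, show i = level a by omega, ← hM.level_apply hF, ← hM.level_apply hF]
  exact S.level_lt (hM.apply_lt_of_covBy hF ha)

theorem level_apply_lt {F : T → T} (hF : F ∈ M) {a : T} {i : ℕ} (h : level a < i) :
    level (F a) < lev F i := by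
  rw [hM.level_apply hF]
  exact hM.lev_strictMono hF h

theorem level_apply_lt_succ {F : T → T} (hF : F ∈ M) {a : T} {i : ℕ} (h : level a < i + 1) :
    level (F a) < lev F i + 1 := by
  rw [hM.level_apply hF, Nat.lt_succ_iff]
  exact (hM.lev_strictMono hF).monotone (by omega)

theorem le_lev {F : T → T} (hF : F ∈ M) (i : ℕ) : i ≤ lev F i :=
  (hM.lev_strictMono hF).le_apply

theorem agree_comp_right {F G K : T → T} {m i : ℕ} (h : Agree m F G) (hK : K ∈ M)
    (hi : ∀ j < i, lev K j < m) : Agree i (F ∘ K) (G ∘ K) := fun a ha =>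
  h (K a) (by rw [hM.level_apply hK]; exact hi _ ha)

theorem agree_succ_comp_right {F G K : T → T} {i : ℕ} (h : Agree (lev K i + 1) F G) (hK : K ∈ M) :
    Agree (i + 1) (F ∘ K) (G ∘ K) := fun a ha => h (K a) (hM.level_apply_lt_succ hK ha)

theorem skips_iff {F : T → T} (hF : F ∈ M) {m : ℕ} : Skips F m ↔ ∀ i, lev F i ≠ m := by
  simp [Skips, hM.mapsLevel_iff hF]

/-- A strictly increasing sequence of natural numbers is determined by its range. -/
theorem lev_of_skipsOnly {F : T → T} (hF : F ∈ M) {m : ℕ} (h : SkipsOnly F m) (i : ℕ) :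
    lev F i = if i < m then i else i + 1 := by
  have hr : Set.range (lev F) = {m}ᶜ := by
    rw [← h]; ext j; simp [hM.mapsLevel_iff hF]
  let g : ℕ → ℕ := fun i => if i < m then i else i + 1
  have hg : StrictMono g := strictMono_nat_of_lt_succ fun i => by
    simp only [g]; split_ifs <;> omega
  have hgr : Set.range g = {m}ᶜ := by
    ext j
    simp only [Set.mem_range, Set.mem_compl_iff, Set.mem_singleton_iff, g]
    constructor
    · rintro ⟨i, rfl⟩; split_ifs <;> omega
    · intro hj
      by_cases hjm : j < m
      · exact ⟨j, by simp [hjm]⟩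
      · exact ⟨j - 1, by split_ifs <;> omega⟩
  have := (StrictMono.range_inj (hM.lev_strictMono hF) hg).1 (hr.trans hgr.symm)
  exact congrFun this i

/-- A member of `M` is determined on level `m` by its restriction to `T(<m)` if it maps level `m`
as low as possible. -/
theorem agree_succ {F G : T → T} (hF : F ∈ M) (hG : G ∈ M) {m : ℕ} (h : Agree m F G)
    (hF' : ∀ j, (∀ i < m, lev F i < j) → lev F m ≤ j) (hl : lev F m = lev G m) : Agree (m + 1) F G := by
  intro b hb
  rcases Nat.lt_succ_iff_lt_or_eq.1 hb with hb | hb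
  · exact h b hb
  rcases Nat.eq_zero_or_pos m with rfl | hm
  · have h0 : lev F 0 = 0 := by
      have := hF' 0 (by simp)
      omega
    rw [← S.eq_of_le ((hM.shapePreserving F hF).root_le b b hb le_rfl)
        (by rw [hM.level_apply hF, hb]; omega),
      ← S.eq_of_le ((hM.shapePreserving G hG).root_le b b hb le_rfl)
        (by rw [hM.level_apply hG, hb]; omega)]
  · obtain ⟨a, ha⟩ := S.exists_covBy (b := b) (by omega)
    have hla := S.level_covBy ha
    obtain ⟨p, c, hp⟩ := S.exists_succOp a b ha
    have hlp := S.level_param_lt a p c b hp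
    obtain ⟨x, hx, hxb⟩ := (hM.shapePreserving F hF).succOp_le a p c b hp
    obtain ⟨y, hy, hyb⟩ := (hM.shapePreserving G hG).succOp_le a p c b hp
    have hpp : p.map F = p.map G := List.map_congr_left fun q hq => h q (by
      have := hlp q hq; omega)
    rw [h a (by omega), hpp, hy] at hx
    have hxy : y = x := by simpa using hx
    have hxl := S.level_covBy (S.covBy_of_succOp _ _ _ _ hy)
    -- By minimality level `m` lands directly above the image of the level before it, so the
    -- inequality in (ii) compares nodes of equal level and is an equality, for `F` and `G` alike.
    have hstep : lev F m = lev F (level a) + 1 := by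
      refine le_antisymm (hF' _ fun i hi => ?_) (hM.lev_strictMono hF (by omega))
      exact Nat.lt_succ_of_le ((hM.lev_strictMono hF).monotone (by omega))
    rw [hM.level_apply hG, ← hM.lev_congr hF hG h (by omega)] at hxl
    rw [← S.eq_of_le hxb (by rw [hM.level_apply hF, hb, ← hxy]; omega),
      ← S.eq_of_le hyb (by rw [hM.level_apply hG, hb]; omega), hxy]

end IsSMTree
end ShapeRamsey

/-! ### Decompositions and letters. -/

namespace ShapeRamsey
variable {T : Type u} [PartialOrder T] {A : Type v}

theorem fixing_anti {M : Set (T → T)} {m n : ℕ} (h : m ≤ n) {F : T → T} (hF : F ∈ fixing M n) :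
    F ∈ fixing M m := ⟨hF.1, fun a ha => hF.2 a (ha.trans_le h)⟩

theorem mem_fixing_of_agree {M : Set (T → T)} {n : ℕ} {F G : T → T} (hF : F ∈ M)
    (h : Agree n F G) (hG : G ∈ fixing M n) : F ∈ fixing M n := ⟨hF, h.trans hG.2⟩

namespace IsSMTree
variable {S : STree T A} {M : Set (T → T)} (hM : IsSMTree S M)
include hM

theorem id_mem_fixing (n : ℕ) : (id : T → T) ∈ fixing M n := ⟨hM.id_mem, fun _ _ => rfl⟩

theorem comp_mem_fixing {n : ℕ} {F G : T → T} (hF : F ∈ fixing M n) (hG : G ∈ fixing M n) :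
    F ∘ G ∈ fixing M n := by
  refine ⟨hM.comp_mem F hF.1 G hG.1, fun a ha => ?_⟩
  rw [Function.comp_apply, hG.2 a ha, hF.2 a ha]

theorem lev_of_mem_fixing {n : ℕ} {F : T → T} (hF : F ∈ fixing M n) {i : ℕ} (hi : i < n) :
    lev F i = i := by
  rw [hM.lev_congr hF.1 hM.id_mem hF.2 hi, hM.lev_id]

theorem mem_fixing_of_lev {n : ℕ} {F : T → T} (hF : F ∈ M) (h : ∀ i < n, lev F i = i) :
    F ∈ fixing M n := by
  refine ⟨hF, ?_⟩
  induction n with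
  | zero => exact fun a ha => absurd ha (Nat.not_lt_zero _)
  | succ n ih =>
    have hn := ih fun i hi => h i (by omega)
    have hid := h n (by omega)
    refine hM.agree_succ hF hM.id_mem hn (fun j hj => ?_)
      (by rw [hid, hM.lev_id])
    rw [hid]
    by_contra! hjn
    have := hj j hjn
    rw [h j (by omega)] at this
    exact lt_irrefl _ this

theorem mem_fixing_of_skipsOnly {F : T → T} (hF : F ∈ M) {m : ℕ} (h : SkipsOnly F m) :
    F ∈ fixing M m :=
  hM.mem_fixing_of_lev hF fun i hi => by rw [hM.lev_of_skipsOnly hF h, if_pos hi]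

/-- `F` fixes the predecessor of `b` and the parameters, so the successor that (ii) places below `F
b` is `b` itself. -/
theorem le_apply {n : ℕ} {F : T → T} (hF : F ∈ fixing M n) {b : T} (hb : level b < n + 1) :
    b ≤ F b := by
  rcases Nat.eq_zero_or_pos (level b) with h0 | h0
  · exact (hM.shapePreserving F hF.1).root_le b b h0 le_rfl
  obtain ⟨a, ha⟩ := S.exists_covBy h0
  have hla := S.level_covBy ha
  obtain ⟨p, c, hp⟩ := S.exists_succOp a b ha
  have hlp := S.level_param_lt a p c b hp
  obtain ⟨x, hx, hxb⟩ := (hM.shapePreserving F hF.1).succOp_le a p c b hp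
  have hpp : p.map F = p := by
    conv_rhs => rw [← List.map_id p]
    exact List.map_congr_left fun q hq => hF.2 q (by have := hlp q hq; omega)
  rw [hF.2 a (by omega), hpp, hp] at hx
  rw [← Option.some.inj hx] at hxb
  exact hxb

/-- Iterated decomposition: every level `c` above the images of the levels `< a` can serve as
intermediate level for level `a`. -/
theorem exists_decomposition {a c : ℕ} : ∀ {F : T → T}, F ∈ M → c ≤ lev F a →
    (∀ i < a, lev F i < c) → ∃ G ∈ M, ∃ L ∈ fixing M c, lev G a = c ∧
      (∀ t, lev L (c + t) = lev F a + t) ∧ Agree (a + 1) (L ∘ G) F ∧ Agree a G F := by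
  have main : ∀ d, ∀ F : T → T, F ∈ M → lev F a = c + d → (∀ i < a, lev F i < c) →
      ∃ G ∈ M, ∃ L ∈ fixing M c, lev G a = c ∧
      (∀ t, lev L (c + t) = lev F a + t) ∧ Agree (a + 1) (L ∘ G) F := by
    intro d
    induction d with
    | zero =>
      intro F hF hFa hi
      exact ⟨F, hF, id, hM.id_mem_fixing c, hFa, fun t => by rw [hM.lev_id, hFa]; rfl,
        fun _ _ => rfl⟩
    | succ d ih =>
      intro F hF hFa hi
      -- Levels below `a` land below `c`, all others at `c + d + 1` or higher.
      have hskip : Skips F (c + d) := by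
        rw [hM.skips_iff hF]
        intro i hic
        by_cases hia : i < a
        · have := hi i hia; omega
        · have := (hM.lev_strictMono hF).monotone (show a ≤ i by omega); omega
      obtain ⟨F₁, h1, F₂, h2, hs, hF12⟩ := hM.decomposition a (c + d) F hF
        ((hM.mapsLevel_iff hF).2 (by omega)) hskip
      have hl2 := hM.lev_of_skipsOnly h2 hs
      have hag : Agree (a + 1) (F₂ ∘ F₁) F := fun b hb => hF12 b (by omega)
      have hlev : ∀ i ≤ a, lev F₂ (lev F₁ i) = lev F i := fun i hi => by
        rw [← hM.lev_comp h2 h1]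
        exact hM.lev_congr (hM.comp_mem F₂ h2 F₁ h1) hF hag (by omega)
      have ha1 : lev F₁ a = c + d := by
        have := hlev a le_rfl
        rw [hl2] at this
        split_ifs at this <;> omega
      obtain ⟨G, hG, L, hL, hGa, hLt, hLG⟩ := ih F₁ h1 ha1 fun i hia => by
        have h3 := hlev i hia.le
        have h4 := hi i hia
        have h5 := hM.le_lev h2 (lev F₁ i)
        omega
      refine ⟨G, hG, F₂ ∘ L, hM.comp_mem_fixing
        (fixing_anti (by omega) (hM.mem_fixing_of_skipsOnly h2 hs)) hL, hGa, fun t => ?_, ?_⟩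
      · rw [hM.lev_comp h2 hL.1, hLt, hl2, if_neg (by omega)]
        omega
      · exact (hLG.comp_left F₂).trans hag
  intro F hF hc hi
  obtain ⟨G, hG, L, hL, hGa, hLt, hLG⟩ := main (lev F a - c) F hF (by omega) hi
  refine ⟨G, hG, L, hL, hGa, hLt, hLG, fun b hb => ?_⟩
  rw [← hLG b (by omega), Function.comp_apply, hL.2 _ (by
    have := hM.level_apply_lt hG hb; omega)]

/-- Beyond any level, a member of `M` can be replaced by one that skips no further levels. -/
theorem exists_agree_lev_add {F : T → T} (hF : F ∈ M) (a : ℕ) :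
    ∃ G ∈ M, Agree (a + 1) G F ∧ ∀ t, lev G (a + t) = lev F a + t := by
  induction a with
  | zero =>
    obtain ⟨G, hG, L, hL, hG0, hLt, hLG, -⟩ :=
      hM.exists_decomposition (a := 0) (c := 0) hF (Nat.zero_le _) (by simp)
    refine ⟨L, hL.1, fun b hb => ?_, hLt⟩
    have := (hM.mem_fixing_of_lev (n := 1) hG fun i hi => by
      rw [Nat.lt_one_iff.1 hi, hG0]).2 b hb
    rw [← hLG b hb, Function.comp_apply, this]
  | succ a ih =>
    obtain ⟨F', hF', hF'a, hF't⟩ := ih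
    obtain ⟨G, hG, L, hL, hGa, hLt, hLG, hGF⟩ :=
      hM.exists_decomposition (a := a + 1) (c := lev F a + 1) hF
        (hM.lev_strictMono hF (Nat.lt_succ_self a)) fun i hi =>
          Nat.lt_succ_of_le ((hM.lev_strictMono hF).monotone (by omega))
    have hGF' : Agree (a + 1) G F' := hGF.trans hF'a.symm
    have hm : ∀ j, (∀ i < a + 1, lev G i < j) → lev G (a + 1) ≤ j := fun j hj => by
      have := hj a (by omega)
      rw [hM.lev_congr hG hF hGF (by omega)] at this
      omega
    have hGF'' : Agree (a + 2) G F' := hM.agree_succ hG hF' hGF' hm (by rw [hGa, hF't])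
    refine ⟨L ∘ F', hM.comp_mem L hL.1 F' hF', (hGF''.symm.comp_left L).trans hLG, fun t => ?_⟩
    rw [hM.lev_comp hL.1 hF', add_assoc a 1 t, hF't, ← add_assoc, hLt]

/-- A member of `ℳ^n` mapping level `n` to level `m + 1` arises from one mapping it to level `m`
by composition with some `l ∈ ℳ^m` mapping level `m` to level `m + 1`. -/
theorem exists_letter_comp {n m : ℕ} {w : T → T} (hw : w ∈ fixing M n)
    (hnm : n ≤ m) (hwm : lev w n = m + 1) :
    ∃ l ∈ fixing M m, lev l m = m + 1 ∧ ∃ w' ∈ fixing M n, lev w' n = m ∧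
      Agree (n + 1) w (l ∘ w') := by
  obtain ⟨G, hG, L, hL, hGa, hLt, hLG, hGF⟩ :=
    hM.exists_decomposition (a := n) (c := m) hw.1 (by omega) fun i hi => by
      rw [hM.lev_of_mem_fixing hw hi]; omega
  exact ⟨L, hL, by rw [← hwm]; exact hLt 0, G, mem_fixing_of_agree hG hGF hw, hGa, hLG.symm⟩

/-- Letters at level `N` are transported by `V` to letters at the image of level `N`. -/
theorem exists_letter_comm {N : ℕ} {V l : T → T} (hV : V ∈ M)
    (hVs : lev V (N + 1) = lev V N + 1) (hl : l ∈ fixing M N) (hlN : lev l N = N + 1) :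
    ∃ l' ∈ fixing M (lev V N), lev l' (lev V N) = lev V N + 1 ∧
      Agree (N + 1) (V ∘ l) (l' ∘ V) := by
  have hVl := hM.comp_mem V hV l hl.1
  have hN : lev (V ∘ l) N = lev V N + 1 := by rw [hM.lev_comp hV hl.1, hlN, hVs]
  obtain ⟨G, hG, L, hL, hGa, hLt, hLG, hGF⟩ :=
    hM.exists_decomposition (a := N) (c := lev V N) hVl (by omega) fun i hi => by
      rw [hM.lev_comp hV hl.1, hM.lev_of_mem_fixing hl hi]
      exact hM.lev_strictMono hV hi
  refine ⟨L, hL, by rw [← hN]; exact hLt 0, hLG.symm.trans fun b hb => congrArg L ?_⟩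
  rcases Nat.lt_succ_iff_lt_or_eq.1 hb with hb' | hb'
  · rw [hGF b hb', Function.comp_apply, hl.2 b hb']
  · have hGb : level (G b) = lev V N := by rw [hM.level_apply hG, hb', hGa]
    have h1 : G b ≤ V (l b) := by
      have := hM.le_apply hL (b := G b) (by omega)
      rwa [show L (G b) = V (l b) from hLG b hb] at this
    exact S.eq_of_le_of_le h1 (hM.monotone hV (hM.le_apply hl hb))
      (by rw [hGb, hM.level_apply hV, hb'])

end IsSMTree
end ShapeRamsey

/-! ### Words of letters, duplication and letter invariance. -/

namespace ShapeRamsey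
/-- The composition of the functions named by a word. -/
def word {T : Type u} {α : Type w} (r : α → T → T) (f : List α) : T → T := f.foldr (fun i F => r i ∘ F) id

theorem word_append {T : Type u} {α : Type w} (r : α → T → T) (f g : List α) :
    word r (f ++ g) = word r f ∘ word r g := by
  induction f with
  | nil => rfl
  | cons i f ih =>
    show r i ∘ word r (f ++ g) = (r i ∘ word r f) ∘ word r g
    rw [ih]; rfl

theorem word_singleton {T : Type u} {α : Type w} (r : α → T → T) (i : α) : word r [i] = r i := rfl

variable {T : Type u} [PartialOrder T] {A : Type v}

namespace IsSMTree
variable {S : STree T A} {M : Set (T → T)} (hM : IsSMTree S M)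
include hM

theorem succOp_apply {N : ℕ} {G : T → T} (hG : G ∈ fixing M N) (hGs : lev G (N + 1) = lev G N + 1)
    {a b : T} {p : List T} {c : A} (ha : level a = N) (h : S.succOp a p c = some b) :
    S.succOp (G a) p c = some (G b) := by
  obtain ⟨x, hx, hxb⟩ := (hM.shapePreserving G hG.1).succOp_le a p c b h
  have hpp : p.map G = p := by
    conv_rhs => rw [← List.map_id p]
    exact List.map_congr_left fun q hq => hG.2 q (by
      have := S.level_param_lt a p c b h q hq; omega)
  have hb := S.level_covBy (S.covBy_of_succOp _ _ _ _ h)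
  have hxl := S.level_covBy (S.covBy_of_succOp _ _ _ _ hx)
  rw [hpp] at hx
  rw [hx, S.eq_of_le hxb]
  rw [hxl, hM.level_apply hG.1, hM.level_apply hG.1, hb, ha, hGs]

section Word
variable {α : Type w} {r : α → T → T} {N : ℕ}
  (hr : ∀ i, r i ∈ fixing M N ∧ ∀ t, lev (r i) (N + t) = N + 1 + t)
include hr

theorem word_mem_fixing (f : List α) : word r f ∈ fixing M N := by
  induction f with
  | nil => exact hM.id_mem_fixing N
  | cons i f ih =>
    show r i ∘ word r f ∈ fixing M N
    exact hM.comp_mem_fixing (hr i).1 ih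

theorem lev_word (f : List α) (t : ℕ) : lev (word r f) (N + t) = N + f.length + t := by
  induction f with
  | nil => exact hM.lev_id _
  | cons i f ih =>
    show lev (r i ∘ word r f) (N + t) = _
    rw [hM.lev_comp (hr i).1.1 (hM.word_mem_fixing hr f).1, ih, add_assoc, (hr i).2,
      List.length_cons]
    omega

/-- Duplicating a letter of a word appends this letter to the word. -/
theorem duplication_word {f₁ f₂ : List α} {i : α} {D : T → T} {m : ℕ}
    (hm : m = N + (f₁ ++ i :: f₂).length) (hDm : D ∈ fixing M m)
    (hD : ∀ (a b : T) (p : List T) (c : A) (x : T), level a = N + f₁.length → level b = m →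
      S.succOp a p c = some x → x ≤ b → S.succOp b p c = some (D b)) :
    Agree (N + 1) (D ∘ word r (f₁ ++ i :: f₂)) (word r (f₁ ++ i :: f₂ ++ [i])) := by
  intro a ha
  have hw := fun f => hM.word_mem_fixing hr f
  rw [word_append r (f₁ ++ i :: f₂), word_singleton]
  set f := f₁ ++ i :: f₂ with hf
  simp only [Function.comp_apply]
  rcases Nat.lt_succ_iff_lt_or_eq.1 ha with ha' | ha'
  · rw [(hr i).1.2 a ha', (hw f).2 a ha', hDm.2 a (by omega)]
  have hli : level (r i a) = level a + 1 := by
    rw [hM.level_apply (hr i).1.1, ha']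
    exact (hr i).2 0
  have hai : a ⋖ r i a := by
    refine S.covBy_of_lt (lt_of_le_of_ne (hM.le_apply (hr i).1 ha) fun h => ?_) hli
    rw [← h] at hli
    omega
  obtain ⟨p, c, hp⟩ := S.exists_succOp a _ hai
  -- Every word carries the step from `a` to `r i a` to a step with the same `p` and `c`;
  -- duplication can therefore read it after `f₁` and repeat it at level `m`.
  have hstep : ∀ g : List α, S.succOp (word r g a) p c = some (word r g (r i a)) := fun g =>
    hM.succOp_apply (hw g) (by
      have := hM.lev_word hr g 0
      rw [add_zero] at this
      rw [hM.lev_word hr g 1, this]) ha' hp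
  have hlw : ∀ g : List α, level (word r g a) = N + g.length := fun g => by
    rw [hM.level_apply (hw g).1, ha']
    exact hM.lev_word hr g 0
  have hle : word r f₁ (r i a) ≤ word r f a := by
    rw [hf, word_append]
    exact hM.monotone (hw f₁).1 (hM.monotone (hr i).1.1 (hM.le_apply (hw f₂) ha))
  have := hD _ _ p c _ (hlw f₁) (by rw [hlw f, hm]) (hstep f₁) hle
  rw [hstep f] at this
  exact (Option.some.inj this).symm

/-- Variable words are realised by members of `ℳ^N`, provided that their constant initial
segment contains all letters. -/
theorem exists_variable_word {f : List α} (hf : ∀ i, i ∈ f) (v : List (Option α)) :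
    ∃ H ∈ fixing M N, Agree (N + 1) H (word r f) ∧
      ∀ i, Agree (N + 1) (H ∘ r i) (word r (f ++ i :: v.map (·.getD i))) := by
  have hw := fun f => hM.word_mem_fixing hr f
  induction v using List.reverseRecOn with
  | nil =>
    refine ⟨word r f, hw f, fun _ _ => rfl, fun i => ?_⟩
    rw [List.map_nil, word_append, word_singleton]
    exact fun _ _ => rfl
  | append_singleton v o ih =>
    obtain ⟨H, hH, hHf, hHi⟩ := ih
    -- The level to which the current instances send level `N`. It exceeds that of `word r f`, which
    -- the duplication thus leaves alone.
    set m := N + f.length + 1 + v.length with hm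
    have key : ∀ k < m, (∀ D ∈ fixing M m, (∀ (a b : T) (p : List T) (c : A) (x : T),
        level a = k → level b = m →
        S.succOp a p c = some x → x ≤ b → S.succOp b p c = some (D b)) → ∀ i,
          Agree (N + 1) (D ∘ word r (f ++ i :: v.map (·.getD i)))
            (word r (f ++ i :: v.map (·.getD i) ++ [o.getD i]))) →
        ∃ H ∈ fixing M N, Agree (N + 1) H (word r f) ∧
          ∀ i, Agree (N + 1) (H ∘ r i) (word r (f ++ i :: (v ++ [o]).map (·.getD i))) := by
      intro k hk h
      obtain ⟨D, hD, hDs, hDd⟩ := hM.duplication k m hk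
      have hDm := hM.mem_fixing_of_skipsOnly hD hDs
      refine ⟨D ∘ H, hM.comp_mem_fixing (fixing_anti (by omega) hDm) hH, fun a ha => ?_,
        fun i => ?_⟩
      · rw [Function.comp_apply, hHf a ha, hDm.2]
        have h1 := hM.level_apply_lt_succ (hw f).1 ha
        have h2 := hM.lev_word hr f 0
        simp only [add_zero] at h2
        omega
      · have := ((hHi i).comp_left D).trans (h D hDm hDd i)
        simpa [Function.comp_assoc] using this
    -- A variable is copied from the position right after `f`, a constant from an occurrence in `f`.
    cases o with
    | none =>
      refine key (N + f.length) (by omega) fun D hDm hD i => ?_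
      exact hM.duplication_word hr (by simp [hm]; omega) hDm hD
    | some j =>
      obtain ⟨f₁, f₂, hff⟩ := List.append_of_mem (hf j)
      refine key (N + f₁.length) (by rw [hm, hff]; simp; omega) fun D hDm hD i => ?_
      have := hM.duplication_word hr (f₁ := f₁) (f₂ := f₂ ++ i :: v.map (·.getD i)) (i := j)
        (by simp [hm, hff]; omega) hDm hD
      simpa [hff] using this

end Word

/-- For every finite colouring of `ℳ^N` depending on the restrictions to `T(≤N)` only,
composition with some `H` cannot distinguish the identity from the members of `ℳ^N` mapping
level `N` to level `N + 1`. -/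
theorem exists_letter_invariant {C : Type w} [Finite C] (N : ℕ) (c : (T → T) → C)
    (hc : ∀ F ∈ fixing M N, ∀ G ∈ fixing M N, Agree (N + 1) F G → c F = c G) :
    ∃ H ∈ fixing M N, (∀ t, lev H (N + 1 + t) = lev H (N + 1) + t) ∧
      ∀ l ∈ fixing M N, lev l N = N + 1 → c (H ∘ l) = c H := by
  -- The alphabet: letters at `N` skipping nothing further up, modulo agreement on T(≤N).
  obtain ⟨s, hs, hsf, hsr⟩ := S.exists_finite_reps (N + 1) (N + 2)
    {l | l ∈ fixing M N ∧ ∀ t, lev l (N + t) = N + 1 + t} fun l hl a ha => by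
      have h := hM.level_apply_lt_succ hl.1.1 ha
      have := hl.2 0
      simp only [add_zero] at this
      omega
  have : Finite s := hsf
  have hr : ∀ i : s, i.1 ∈ fixing M N ∧ ∀ t, lev i.1 (N + t) = N + 1 + t := fun i => hs i.2
  obtain ⟨f₀, hf₀⟩ : ∃ f₀ : List s, ∀ i, i ∈ f₀ := by
    have := Fintype.ofFinite s
    exact ⟨Finset.univ.toList, by simp⟩
  obtain ⟨f, v, hfv⟩ := hasLeftLine_of_finite fun f : List s =>
    c (word Subtype.val (f₀ ++ f))
  obtain ⟨H', hH', hHf, hHi⟩ := hM.exists_variable_word hr (f := f₀ ++ f)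
    (fun i => List.mem_append_left _ (hf₀ i)) v
  obtain ⟨H, hH, hHH', hHt⟩ := hM.exists_agree_lev_add hH'.1 (N + 1)
  have hHN : H ∈ fixing M N := mem_fixing_of_agree hH (hHH'.mono (by omega)) hH'
  have hlev : lev H (N + 1) = lev H' (N + 1) := hM.lev_congr hH hH'.1 hHH' (by omega)
  refine ⟨H, hHN, fun t => by rw [hHt, hlev], fun l hl hlN => ?_⟩
  obtain ⟨l', hl', hll', hlt'⟩ := hM.exists_agree_lev_add hl.1 N
  have hl'N : l' ∈ fixing M N := mem_fixing_of_agree hl' (hll'.mono (by omega)) hl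
  obtain ⟨i, his, hi⟩ := hsr l' ⟨hl'N, fun t => by rw [hlt', hlN]⟩
  have hli : Agree (N + 1) l i := hll'.symm.trans hi
  have hw := fun f => hM.word_mem_fixing hr f
  have hagi : Agree (N + 1) (H ∘ l) (word Subtype.val
      (f₀ ++ f ++ (⟨i, his⟩ : s) :: v.map (·.getD ⟨i, his⟩))) := by
    refine Agree.trans ?_ (hHi ⟨i, his⟩)
    refine Agree.trans (hli.comp_left H) ?_
    exact hM.agree_succ_comp_right (hHH'.mono (by
      have := (hs his).2 0
      simp only [add_zero] at this
      omega)) (hs his).1.1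
  rw [hc _ (hM.comp_mem_fixing hHN hl) _ (hw _) hagi,
    hc H hHN _ (hw _) ((hHH'.mono (by omega)).trans hHf)]
  have := hfv ⟨i, his⟩
  simpa using this.symm

end IsSMTree
end ShapeRamsey

/-! ### Limits, fusion and large properties. -/

namespace ShapeRamsey
variable {T : Type u} [PartialOrder T] {A : Type v}

namespace IsSMTree
variable {S : STree T A} {M : Set (T → T)} (hM : IsSMTree S M)
include hM

/-- Sequences in `M` which stabilise on initial segments of the tree have limits in `M`. -/
theorem exists_limit {f : ℕ → T → T} {b : ℕ → ℕ} (hb : Monotone b) (hbi : ∀ i, i ≤ b i)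
    (hf : ∀ i, f i ∈ M) (h : ∀ i, Agree (b i) (f i) (f (i + 1))) :
    ∃ G ∈ M, ∀ i, Agree (b i) G (f i) := by
  have hle : ∀ i d, Agree (b i) (f i) (f (i + d)) := by
    intro i d
    induction d with
    | zero => exact fun _ _ => rfl
    | succ d ih => exact ih.trans ((h (i + d)).mono (hb (by omega)))
  obtain ⟨G, hG, hGf⟩ := hM.limit_mem (fun i => f (i + 1)) (fun i => hf _) fun i a ha =>
    h (i + 1) a (by have := hbi (i + 1); omega)
  refine ⟨G, hG, fun i a ha => ?_⟩
  rw [hGf (level a) a le_rfl]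
  rcases le_total i (level a + 1) with hi | hi
  · obtain ⟨d, hd⟩ := Nat.exists_eq_add_of_le hi
    rw [hd]
    exact (hle i d a ha).symm
  · obtain ⟨d, hd⟩ := Nat.exists_eq_add_of_le hi
    rw [hd]
    exact hle _ d a (by have := hbi (level a + 1); omega)

/-- Fusion: properties which can be made to hold on `F ∘ ℳ^i` by passing to `F ∘ G`, `G ∈ ℳ^i`,
can be made to hold simultaneously for all `i ≥ N`. -/
theorem exists_fusion {N : ℕ} {p : ℕ → (T → T) → Prop}
    (h : ∀ i, N ≤ i → ∀ F ∈ fixing M N, ∃ G ∈ fixing M i, ∀ g ∈ fixing M i, p i (F ∘ G ∘ g)) :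
    ∃ K ∈ fixing M N, ∀ i, N ≤ i → ∀ g ∈ fixing M i, p i (K ∘ g) := by
  have : Nonempty (T → T) := ⟨id⟩
  choose! k hk hkp using fun i => h (N + i) (by omega)
  -- `Q i` is the product of the first `i` corrections, `R i j` that of the next `j`. The limits of
  -- the tails `R i` let the limit `K` factor through each correction.
  let Q : ℕ → T → T := fun i => Nat.rec id (fun i F => F ∘ k i F) i
  have hQs : ∀ i, Q (i + 1) = Q i ∘ k i (Q i) := fun i => rfl
  have hQ : ∀ i, Q i ∈ fixing M N := by
    intro i
    induction i with
    | zero => exact hM.id_mem_fixing N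
    | succ i ih => exact hM.comp_mem_fixing ih (fixing_anti (by omega) (hk i _ ih))
  let R : ℕ → ℕ → T → T := fun i j => Nat.rec id (fun j F => F ∘ k (i + j) (Q (i + j))) j
  have hRs : ∀ i j, R i (j + 1) = R i j ∘ k (i + j) (Q (i + j)) := fun i j => rfl
  have hR : ∀ i j, R i j ∈ fixing M (N + i) := by
    intro i j
    induction j with
    | zero => exact hM.id_mem_fixing _
    | succ j ih => exact hM.comp_mem_fixing ih (fixing_anti (by omega) (hk _ _ (hQ _)))
  have hQR : ∀ i j, Q (i + j) = Q i ∘ R i j := by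
    intro i j
    induction j with
    | zero => rfl
    | succ j ih => rw [← add_assoc, hQs, hRs, ← Function.comp_assoc, ← ih]
  have hlim : ∀ i, ∃ L ∈ fixing M (N + i), ∀ j, Agree (N + i + j) L (R i j) := by
    intro i
    obtain ⟨L, hL, hLR⟩ := hM.exists_limit (f := R i) (b := fun j => N + i + j)
      (fun j j' hjj => by simpa using hjj) (fun j => by omega) (fun j => (hR i j).1)
      fun j a ha => by
        rw [hRs, Function.comp_apply, (hk _ _ (hQ _)).2 a (by omega)]
    exact ⟨L, mem_fixing_of_agree hL (hLR 0) (hM.id_mem_fixing _), hLR⟩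
  obtain ⟨K, hK, hKR⟩ := hlim 0
  refine ⟨K, hK, fun i hi g hg => ?_⟩
  obtain ⟨i, rfl⟩ := Nat.exists_eq_add_of_le hi
  obtain ⟨L, hL, hLR⟩ := hlim (i + 1)
  have hKL : K = Q i ∘ k i (Q i) ∘ L := by
    rw [← Function.comp_assoc, ← hQs]
    funext a
    have h1 := hKR (i + 1 + (level a + 1)) a (by omega)
    have h2 : R 0 (i + 1 + (level a + 1)) = Q (i + 1 + (level a + 1)) := by
      have := hQR 0 (i + 1 + (level a + 1))
      rw [zero_add] at this
      rw [this]; rfl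
    rw [h1, h2, hQR, Function.comp_apply, Function.comp_apply, hLR (level a + 1) a (by omega)]
  rw [hKL]
  exact hkp i (Q i) (hQ i) (L ∘ g) (hM.comp_mem_fixing (fixing_anti (by omega) hL) hg)

/-- Finitely many properties which can be made to hold on subspaces can be made to hold
simultaneously. -/
theorem exists_forall_mem_finite {ι : Type w} {s : Set ι} (hs : s.Finite) {N i : ℕ} (hNi : N ≤ i)
    {p : ι → (T → T) → Prop}
    (h : ∀ x ∈ s, ∀ F ∈ fixing M N, ∃ G ∈ fixing M i, ∀ g ∈ fixing M i, p x (F ∘ G ∘ g)) :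
    ∀ F ∈ fixing M N, ∃ G ∈ fixing M i, ∀ g ∈ fixing M i, ∀ x ∈ s, p x (F ∘ G ∘ g) := by
  induction s, hs using Set.Finite.induction_on with
  | empty => exact fun F _ => ⟨id, hM.id_mem_fixing i, fun _ _ x hx => absurd hx (by simp)⟩
  | @insert x s _ _ ih =>
    intro F hF
    obtain ⟨G, hG, hGs⟩ := ih (fun y hy => h y (Set.mem_insert_of_mem x hy)) F hF
    obtain ⟨G', hG', hGx⟩ := h x (Set.mem_insert x s) (F ∘ G)
      (hM.comp_mem_fixing hF (fixing_anti hNi hG))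
    refine ⟨G ∘ G', hM.comp_mem_fixing hG hG', fun g hg y hy => ?_⟩
    rcases hy with rfl | hy
    · exact hGx g hg
    · exact hGs (G' ∘ g) (hM.comp_mem_fixing hG' hg) y hy

end IsSMTree

/-- `p` is large on `ℳ^N` if it meets every subspace `G ∘ ℳ^N`. -/
def Large (M : Set (T → T)) (N : ℕ) (p : (T → T) → Prop) : Prop :=
  ∀ G ∈ fixing M N, ∃ g ∈ fixing M N, p (G ∘ g)

namespace IsSMTree
variable {S : STree T A} {M : Set (T → T)} (hM : IsSMTree S M)
include hM

/-- Large properties have witnesses of bounded height. -/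
theorem exists_bound_of_large {N : ℕ} {p : (T → T) → Prop} (hp : Large M N p)
    (hpc : ∀ F ∈ fixing M N, ∀ G ∈ fixing M N, Agree (N + 1) F G → p F → p G)
    {K : T → T} (hK : K ∈ fixing M N) :
    ∃ i, N ≤ i ∧ ∀ g ∈ fixing M i, ∃ w ∈ fixing M N, lev w N = i ∧ p (K ∘ g ∘ w) := by
  by_contra! hcon
  have : Nonempty (T → T) := ⟨id⟩
  choose! g hg hgw using hcon
  -- Stage `t` composes with the bad map for the level where `N + t` currently lands. A witness for
  -- the limit sending `N` to `N + t` contradicts the badness of that map.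
  let R : ℕ → T → T := fun t => Nat.rec id (fun t F => g (lev F (N + t)) ∘ F) t
  have hRs : ∀ t, R (t + 1) = g (lev (R t) (N + t)) ∘ R t := fun t => rfl
  have hR : ∀ t, R t ∈ fixing M N := by
    intro t
    induction t with
    | zero => exact hM.id_mem_fixing N
    | succ t ih =>
      have hle : N ≤ lev (R t) (N + t) := (Nat.le_add_right N t).trans (hM.le_lev ih.1 (N + t))
      exact hM.comp_mem_fixing (fixing_anti hle (hg _ hle)) ih
  have hle : ∀ t, N ≤ lev (R t) (N + t) := fun t => by
    have := hM.le_lev (hR t).1 (N + t); omega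
  obtain ⟨L, hL, hLR⟩ := hM.exists_limit (f := R) (b := fun t => N + t)
    (fun j j' hjj => by simpa using hjj) (fun j => by omega) (fun j => (hR j).1) fun t a ha => by
      rw [hRs, Function.comp_apply, (hg _ (hle t)).2 _ (hM.level_apply_lt (hR t).1 ha)]
  have hLN : L ∈ fixing M N := mem_fixing_of_agree hL (hLR 0) (hM.id_mem_fixing _)
  obtain ⟨w, hw, hpw⟩ := hp (K ∘ L) (hM.comp_mem_fixing hK hLN)
  obtain ⟨t, ht⟩ := Nat.exists_eq_add_of_le (hM.le_lev hw.1 N)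
  have hgt := hg _ (hle t)
  have hRw := hM.comp_mem_fixing (hR t) hw
  refine hgw _ (hle t) (R t ∘ w) hRw (by rw [hM.lev_comp (hR t).1 hw.1, ht]) ?_
  refine hpc _ (hM.comp_mem_fixing (hM.comp_mem_fixing hK hLN) hw) _
    (hM.comp_mem_fixing hK (hM.comp_mem_fixing (fixing_anti (hle t) hgt) hRw)) ?_ hpw
  have : Agree (N + 1) (L ∘ w) (R (t + 1) ∘ w) :=
    hM.agree_succ_comp_right ((hLR (t + 1)).mono (by omega)) hw.1
  exact this.comp_left K

end IsSMTree
end ShapeRamsey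

/-! ### The pigeonhole principle. -/

namespace ShapeRamsey
variable {T : Type u} [PartialOrder T] {A : Type v}

namespace IsSMTree
variable {S : STree T A} {M : Set (T → T)} (hM : IsSMTree S M)
include hM

theorem lev_lt_of_letter {l : T → T} {N : ℕ} (hl : l ∈ fixing M N) (hlN : lev l N = N + 1)
    {i : ℕ} (hi : i < N + 1) : lev l i < N + 2 := by
  have := (hM.lev_strictMono hl.1).monotone (show i ≤ N by omega)
  omega

/-- The inductive step of the pigeonhole principle: a large property `p` holds at some `P ∘ V`,
such that for all letters `l` simultaneously it is still large above `V ∘ l`. -/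
theorem exists_large_step {N : ℕ} {p : (T → T) → Prop} (hp : Large M N p)
    (hpc : ∀ F ∈ fixing M N, ∀ G ∈ fixing M N, Agree (N + 1) F G → p F → p G) :
    ∃ P ∈ fixing M N, ∃ V ∈ fixing M N, (∀ t, lev V (N + 1 + t) = lev V (N + 1) + t) ∧
      p (P ∘ V) ∧ Large M (lev V (N + 1)) fun g =>
        ∀ l ∈ fixing M N, lev l N = N + 1 → p (P ∘ g ∘ V ∘ l) := by
  by_contra! hcon
  -- If the claim fails, one `K` witnesses this for all `V`: whenever `p` holds at `K ∘ g ∘ V`, it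
  -- fails at `K ∘ g ∘ V ∘ l` for some letter `l`.
  obtain ⟨K, hK, hKp⟩ := hM.exists_fusion (N := N) (p := fun i F => ∀ V ∈ fixing M N,
      (∀ t, lev V (N + 1 + t) = lev V (N + 1) + t) → lev V (N + 1) = i → p (F ∘ V) →
      ∃ l ∈ fixing M N, lev l N = N + 1 ∧ ¬ p (F ∘ V ∘ l)) (by
    intro i hNi F hF
    obtain ⟨s, hs, hsf, hsr⟩ := S.exists_finite_reps (N + 2) (i + 1) {V | V ∈ fixing M N ∧
      (∀ t, lev V (N + 1 + t) = lev V (N + 1) + t) ∧ lev V (N + 1) = i} (by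
        rintro V ⟨hV, -, rfl⟩ a ha
        exact hM.level_apply_lt_succ hV.1 ha)
    obtain ⟨G, hG, hGs⟩ := hM.exists_forall_mem_finite hsf hNi (p := fun V F => p (F ∘ V) →
      ∃ l ∈ fixing M N, lev l N = N + 1 ∧ ¬ p (F ∘ V ∘ l)) (by
        intro V hV F hF
        obtain ⟨hVN, hVt, hVi⟩ := hs hV
        by_cases hpF : p (F ∘ V)
        · have := hcon F hF V hVN hVt hpF
          simp only [Large, not_forall, not_exists, not_and, hVi] at this
          obtain ⟨G, hG, hGg⟩ := this
          refine ⟨G, hG, fun g hg _ => ?_⟩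
          obtain ⟨l, hl, hlN, hlp⟩ := hGg g hg
          exact ⟨l, hl, hlN, hlp⟩
        · refine ⟨id, hM.id_mem_fixing i, fun g hg h => absurd ?_ hpF⟩
          have hgN := fixing_anti hNi hg
          refine hpc _ (hM.comp_mem_fixing (hM.comp_mem_fixing hF
            (hM.comp_mem_fixing (hM.id_mem_fixing N) hgN)) hVN) _ (hM.comp_mem_fixing hF hVN) ?_ h
          refine fun a ha => congrArg F ?_
          exact hg.2 _ (by rw [← hVi]; exact hM.level_apply_lt hVN.1 ha)) F hF
    refine ⟨G, hG, fun g hg V hV hVt hVi hpV => ?_⟩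
    obtain ⟨V', hV', hVV'⟩ := hsr V ⟨hV, hVt, hVi⟩
    have hFGg := hM.comp_mem_fixing hF (hM.comp_mem_fixing (fixing_anti hNi hG)
      (fixing_anti hNi hg))
    have hV'N := (hs hV').1
    obtain ⟨l, hl, hlN, hpl⟩ := hGs g hg V' hV' (hpc _ (hM.comp_mem_fixing hFGg hV) _
      (hM.comp_mem_fixing hFGg hV'N) ((hVV'.mono (by omega)).comp_left _) hpV)
    refine ⟨l, hl, hlN, fun h => hpl (hpc _ (hM.comp_mem_fixing hFGg (hM.comp_mem_fixing hV hl)) _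
      (hM.comp_mem_fixing hFGg (hM.comp_mem_fixing hV'N hl)) (Agree.comp_left ?_ _) h)⟩
    exact hM.agree_comp_right hVV' hl.1 fun j hj => hM.lev_lt_of_letter hl hlN hj)
  obtain ⟨i, hNi, hi⟩ := hM.exists_bound_of_large hp hpc hK
  obtain ⟨s, hs, hsf, hsr⟩ := S.exists_finite_reps (N + 1) (i + 1) {w | w ∈ fixing M N ∧
    (∀ t, lev w (N + t) = i + t)} (by
      rintro w ⟨hw, hwt⟩ a ha
      have h1 := hM.level_apply_lt_succ hw.1 ha
      have h2 := hwt 0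
      simp only [add_zero] at h2
      omega)
  have : Finite s := hsf
  have hKyw : ∀ y ∈ fixing M i, ∀ w ∈ fixing M N, K ∘ y ∘ w ∈ fixing M N := fun y hy w hw =>
    hM.comp_mem_fixing hK (hM.comp_mem_fixing (fixing_anti hNi hy) hw)
  have hagw : ∀ F G : T → T, Agree (i + 1) F G → ∀ w ∈ s,
      Agree (N + 1) (K ∘ F ∘ w) (K ∘ G ∘ w) := fun F G hFG w hw => by
    have := (hs hw).2 0
    exact (hM.agree_succ_comp_right (hFG.mono (by simp only [add_zero] at this; omega))
      (hs hw).1.1).comp_left K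
  -- The colour of `y` records all representatives `w` sending `N` to `i` with `p (K ∘ y ∘ w)`.
  obtain ⟨H, hH, hHt, hHl⟩ := hM.exists_letter_invariant i
    (fun y => {w : s | p (K ∘ y ∘ w.1)}) (by
      intro F hF G hG hFG
      ext w
      have hw := (hs w.2).1
      exact ⟨hpc _ (hKyw F hF w hw) _ (hKyw G hG w hw) (hagw F G hFG w w.2),
        hpc _ (hKyw G hG w hw) _ (hKyw F hF w hw) (hagw G F hFG.symm w w.2)⟩)
  obtain ⟨w₀, hw₀, hw₀i, hpw₀⟩ := hi H hH
  obtain ⟨w₁, hw₁, hw₁₀, hw₁t⟩ := hM.exists_agree_lev_add hw₀.1 N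
  have hw₁N : w₁ ∈ fixing M N := mem_fixing_of_agree hw₁ (hw₁₀.mono (by omega)) hw₀
  obtain ⟨w, hws, hww₁⟩ := hsr w₁ ⟨hw₁N, by simpa only [hw₀i] using hw₁t⟩
  obtain ⟨hw, hwt⟩ := hs hws
  have hw0 : lev w N = i := hwt 0
  have hw1 : lev w (N + 1) = i + 1 := hwt 1
  have hpHw : p (K ∘ H ∘ w) := hpc _ (hKyw H hH w₀ hw₀) _ (hKyw H hH w hw)
    (((hw₁₀.symm.trans hww₁).comp_left H).comp_left K) hpw₀
  have hHN := fixing_anti hNi hH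
  have hV := hM.comp_mem_fixing hHN hw
  have hVt : ∀ t, lev (H ∘ w) (N + 1 + t) = lev (H ∘ w) (N + 1) + t := fun t => by
    rw [hM.lev_comp hHN.1 hw.1, hM.lev_comp hHN.1 hw.1, add_assoc, hwt, hw1, ← add_assoc, hHt]
  have hNV : N ≤ lev (H ∘ w) (N + 1) := by
    have := hM.le_lev hV.1 (N + 1); omega
  obtain ⟨l, hl, hlN, hpl⟩ := hKp _ hNV id (hM.id_mem_fixing _) (H ∘ w) hV hVt rfl hpHw
  refine hpl ?_
  -- On T(≤N), `w ∘ l` is `l' ∘ w` for a letter `l'` at `i`, and `H` was chosen to ignore such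
  -- letters.
  obtain ⟨l', hl', hl'i, hll'⟩ := hM.exists_letter_comm hw.1 (by rw [hw1, hw0]) hl hlN
  rw [hw0] at hl' hl'i
  have hmem : (⟨w, hws⟩ : s) ∈ {w : s | p (K ∘ (H ∘ l') ∘ w.1)} := by
    have h : (⟨w, hws⟩ : s) ∈ {w : s | p (K ∘ H ∘ w.1)} := hpHw
    rwa [← hHl l' hl' hl'i] at h
  exact hpc _ (hKyw _ (hM.comp_mem_fixing hH hl') w hw) _
    (hM.comp_mem_fixing hK (hM.comp_mem_fixing hV hl))
    ((hll'.symm.comp_left H).comp_left K) hmem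

/-- A large property of restrictions to `T(≤n)` holds throughout a subspace. -/
theorem exists_forall_of_large {n : ℕ} {p : (T → T) → Prop} (hp : Large M n p)
    (hpc : ∀ F ∈ fixing M n, ∀ G ∈ fixing M n, Agree (n + 1) F G → p F → p G) :
    ∃ F ∈ fixing M n, ∀ w ∈ fixing M n, p (F ∘ w) := by
  -- New maps are inserted between the two components, so both sequences stabilise; the limit
  -- subspace is the composite of their limits.
  let Inv : ℕ → (T → T) × (T → T) → Prop := fun i x => x.1 ∈ fixing M n ∧ x.2 ∈ fixing M n ∧
    (∀ t, lev x.2 (n + i + t) = lev x.2 (n + i) + t) ∧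
    Large M (lev x.2 (n + i)) fun g => ∀ w ∈ fixing M n, lev w n = n + i → p (x.1 ∘ g ∘ x.2 ∘ w)
  have step : ∀ i x, Inv i x → ∃ y, Inv (i + 1) y ∧ (∃ P ∈ fixing M (lev x.2 (n + i)),
      y.1 = x.1 ∘ P) ∧ (∃ V ∈ fixing M (lev x.2 (n + i)), y.2 = V ∘ x.2) ∧
      ∀ w ∈ fixing M n, lev w n = n + i → p (y.1 ∘ y.2 ∘ w) := by
    rintro i ⟨P, U⟩ ⟨hP, hU, hUt, hL⟩
    simp only at hP hU hUt hL
    set N := lev U (n + i) with hN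
    have hnN : n ≤ N := by have := hM.le_lev hU.1 (n + i); omega
    have hPgUw : ∀ g ∈ fixing M N, ∀ w ∈ fixing M n, P ∘ g ∘ U ∘ w ∈ fixing M n :=
      fun g hg w hw => hM.comp_mem_fixing hP (hM.comp_mem_fixing (fixing_anti hnN hg)
        (hM.comp_mem_fixing hU hw))
    obtain ⟨Q, hQ, V, hV, hVt, hpQV, hLV⟩ := hM.exists_large_step hL (by
      intro F hF G hG hFG h w hw hwn
      refine hpc _ (hPgUw F hF w hw) _ (hPgUw G hG w hw) (Agree.comp_left ?_ P) (h w hw hwn)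
      exact hM.agree_succ_comp_right (by rwa [hM.lev_comp hU.1 hw.1, hwn])
        (hM.comp_mem_fixing hU hw).1)
    have hU1 : lev U (n + (i + 1)) = N + 1 := hUt 1
    have hlev : lev (V ∘ U) (n + (i + 1)) = lev V (N + 1) := by
      rw [hM.lev_comp hV.1 hU.1, hU1]
    have hPQ := hM.comp_mem_fixing hP (fixing_anti hnN hQ)
    have hVU := hM.comp_mem_fixing (fixing_anti hnN hV) hU
    refine ⟨(P ∘ Q, V ∘ U), ⟨hPQ, hVU, fun t => ?_, ?_⟩, ⟨Q, hQ, rfl⟩, ⟨V, hV, rfl⟩,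
      hpQV⟩
    · simp only [hlev]
      rw [hM.lev_comp hV.1 hU.1, ← add_assoc n i 1, add_assoc, hUt, ← add_assoc, hVt]
    · simp only [hlev]
      intro G hG
      obtain ⟨g, hg, hgl⟩ := hLV G hG
      refine ⟨g, hg, fun w hw hwn => ?_⟩
      -- Splitting off the last letter of `w` and moving it past `U` reduces the claim to the
      -- previous height and a letter at `N`.
      obtain ⟨l, hl, hlm, w', hw', hw'n, hww'⟩ :=
        hM.exists_letter_comp (m := n + i) hw (by omega) hwn
      obtain ⟨l', hl', hl'm, hll'⟩ := hM.exists_letter_comm hU.1 hU1 hl hlm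
      have hln := fixing_anti (show n ≤ n + i by omega) hl
      have hNV : N ≤ lev V (N + 1) := by have := hM.le_lev hV.1 (N + 1); omega
      have hGgV := hM.comp_mem_fixing (fixing_anti hNV (hM.comp_mem_fixing hG hg)) hV
      have hQ' := hM.comp_mem_fixing hQ hGgV
      refine hpc _ (hPgUw _ (hM.comp_mem_fixing hQ' hl') w' hw') _ (hPgUw _ hQ' w hw) ?_
        (hgl l' hl' hl'm w' hw' hw'n)
      have : Agree (n + 1) (l' ∘ U ∘ w') (U ∘ w) := by
        refine Agree.trans ?_ (hww'.symm.comp_left U)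
        exact hM.agree_succ_comp_right (F := l' ∘ U) (G := U ∘ l) (by
          rw [hw'n]; exact hll'.symm) hw'.1
      exact (this.comp_left (Q ∘ (G ∘ g) ∘ V)).comp_left P
  have init : Inv 0 (id, id) := by
    refine ⟨hM.id_mem_fixing n, hM.id_mem_fixing n, fun t => by simp only [hM.lev_id], ?_⟩
    simp only [hM.lev_id]
    intro G hG
    obtain ⟨g, hg, hpg⟩ := hp G hG
    refine ⟨g, hg, fun w hw hwn => ?_⟩
    have hwid : w ∈ fixing M (n + 1) := hM.mem_fixing_of_lev hw.1 fun i hi => by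
      rcases Nat.lt_succ_iff_lt_or_eq.1 hi with hi | rfl
      · exact hM.lev_of_mem_fixing hw hi
      · exact hwn
    have hGg : G ∘ g ∈ fixing M n := hM.comp_mem_fixing hG hg
    exact hpc _ hGg _ (hM.comp_mem_fixing (G := w) hGg hw)
      (fun a ha => congrArg (G ∘ g) (hwid.2 a ha).symm) hpg
  have : Nonempty (T → T) := ⟨id⟩
  choose! next hnext hP hU hpn using step
  let x : ℕ → (T → T) × (T → T) := fun i => Nat.rec (id, id) (fun i y => next i y) i
  have hx : ∀ i, Inv i (x i) := by
    intro i
    induction i with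
    | zero => exact init
    | succ i ih => exact hnext i _ ih
  have hxP : ∀ i, ∃ P ∈ fixing M (lev (x i).2 (n + i)), (x (i + 1)).1 = (x i).1 ∘ P :=
    fun i => hP i _ (hx i)
  have hxU : ∀ i, ∃ V ∈ fixing M (lev (x i).2 (n + i)), (x (i + 1)).2 = V ∘ (x i).2 :=
    fun i => hU i _ (hx i)
  have hmono : Monotone fun i => lev (x i).2 (n + i) := monotone_nat_of_le_succ fun i => by
    obtain ⟨V, hV, hVx⟩ := hxU i
    rw [hVx, hM.lev_comp hV.1 (hx i).2.1.1]
    exact ((hM.lev_strictMono (hx i).2.1.1).monotone (by omega)).trans (hM.le_lev hV.1 _)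
  obtain ⟨P, hPM, hPx⟩ := hM.exists_limit hmono
    (fun i => by have := hM.le_lev (hx i).2.1.1 (n + i); omega) (fun i => (hx i).1.1) fun i => by
      obtain ⟨P, hP, hPx⟩ := hxP i
      rw [hPx]
      exact fun a ha => congrArg (x i).1 (hP.2 a ha).symm
  obtain ⟨U, hUM, hUx⟩ := hM.exists_limit (f := fun i => (x i).2) (b := fun i => n + i)
    (fun i j hij => by simpa using hij) (fun i => by omega) (fun i => (hx i).2.1.1) fun i => by
      obtain ⟨V, hV, hVx⟩ := hxU i
      rw [hVx]
      exact fun a ha => (hV.2 _ (hM.level_apply_lt (hx i).2.1.1 ha)).symm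
  have hPn : P ∈ fixing M n := mem_fixing_of_agree hPM ((hPx 0).mono
    (hM.le_lev (hx 0).2.1.1 n)) (hx 0).1
  have hUn : U ∈ fixing M n := mem_fixing_of_agree hUM (hUx 0) (hx 0).2.1
  refine ⟨P ∘ U, hM.comp_mem_fixing hPn hUn, fun w hw => ?_⟩
  obtain ⟨i, hi⟩ := Nat.exists_eq_add_of_le (hM.le_lev hw.1 n)
  refine hpc _ (hM.comp_mem_fixing (hx (i + 1)).1 (hM.comp_mem_fixing (hx (i + 1)).2.1 hw)) _
    (hM.comp_mem_fixing (hM.comp_mem_fixing hPn hUn) hw) ?_ (hpn i _ (hx i) w hw hi)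
  have hUw : Agree (n + 1) ((x (i + 1)).2 ∘ w) (U ∘ w) :=
    hM.agree_succ_comp_right (by rw [hi]; exact (hUx (i + 1)).symm) hw.1
  refine Agree.trans ?_ (hUw.comp_left P)
  have hmem := hM.comp_mem_fixing (hx (i + 1)).2.1 hw
  refine hM.agree_succ_comp_right ((hPx (i + 1)).symm.mono ?_) hmem.1
  rw [hM.lev_comp (hx (i + 1)).2.1.1 hw.1, hi]
  exact hM.lev_strictMono (hx (i + 1)).2.1.1 (by omega)

/-- The pigeonhole principle: the case `k = 1`. -/
theorem exists_monochromatic_one {C : Type w} [Finite C] {n : ℕ} (c : (T → T) → C)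
    (hc : ∀ F ∈ fixing M n, ∀ G ∈ fixing M n, Agree (n + 1) F G → c F = c G) :
    ∃ F ∈ fixing M n, ∃ d, ∀ w ∈ fixing M n, c (F ∘ w) = d := by
  obtain ⟨F, hF, d, hL⟩ : ∃ F ∈ fixing M n, ∃ d, Large M n fun g => c (F ∘ g) = d := by
    -- Otherwise the finitely many colours could be avoided one after another.
    by_contra! hcon
    obtain ⟨G, -, hG⟩ := hM.exists_forall_mem_finite (Set.finite_univ (α := C)) (le_refl n)
      (p := fun d F => c F ≠ d) (fun d _ F hF => by
        have := hcon F hF d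
        simp only [Large, not_forall, not_exists, not_and] at this
        obtain ⟨G, hG, h⟩ := this
        exact ⟨G, hG, h⟩) id (hM.id_mem_fixing n)
    exact hG id (hM.id_mem_fixing n) _ (Set.mem_univ _) rfl
  obtain ⟨G, hG, hGw⟩ := hM.exists_forall_of_large hL fun G hG G' hG' h hd => by
    rw [← hd]
    exact (hc _ (hM.comp_mem_fixing hF hG) _ (hM.comp_mem_fixing hF hG') (h.comp_left F)).symm
  exact ⟨F ∘ G, hM.comp_mem_fixing hF hG, d, hGw⟩

/-! ### Induction on `k`. -/

/-- Finite colourings of `ℳ^n` depending on the restrictions to `T(<n+k)` only are constant on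
some subspace. -/
theorem exists_monochromatic {C : Type w} [Finite C] {n : ℕ} (k : ℕ) : ∀ c : (T → T) → C,
    (∀ F ∈ fixing M n, ∀ G ∈ fixing M n, Agree (n + k) F G → c F = c G) →
    ∃ F ∈ fixing M n, ∃ d, ∀ w ∈ fixing M n, c (F ∘ w) = d := by
  induction k with
  | zero =>
    exact fun c hc => ⟨id, hM.id_mem_fixing n, c id, fun w hw =>
      hc _ (hM.comp_mem_fixing (hM.id_mem_fixing n) hw) _ (hM.id_mem_fixing n) hw.2⟩
  | succ k ih =>
    intro c hc
    obtain ⟨K, hK, hKc⟩ := hM.exists_fusion (N := n) (p := fun i F => ∀ V ∈ fixing M n,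
        lev V (n + k) = i → ∀ h ∈ fixing M i, c (F ∘ h ∘ V) = c (F ∘ V)) (by
      intro i hni F hF
      obtain ⟨s, hs, hsf, hsr⟩ := S.exists_finite_reps (n + k + 1) (i + 1)
        {V | V ∈ fixing M n ∧ lev V (n + k) = i} (by
          rintro V ⟨hV, rfl⟩ a ha
          exact hM.level_apply_lt_succ hV.1 ha)
      obtain ⟨G, hG, hGs⟩ := hM.exists_forall_mem_finite hsf hni (p := fun V F =>
        ∀ h ∈ fixing M i, c (F ∘ h ∘ V) = c (F ∘ V)) (by
          intro V hV F hF
          obtain ⟨hVn, hVi⟩ := hs hV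
          have hFV : ∀ g ∈ fixing M i, F ∘ g ∘ V ∈ fixing M n := fun g hg =>
            hM.comp_mem_fixing hF (hM.comp_mem_fixing (fixing_anti hni hg) hVn)
          obtain ⟨G, hG, d, hGd⟩ := hM.exists_monochromatic_one (n := i)
            (fun g => c (F ∘ g ∘ V)) fun g hg g' hg' hgg' => by
              refine hc _ (hFV g hg) _ (hFV g' hg') (Agree.comp_left ?_ F)
              exact hM.agree_succ_comp_right (i := n + k) (by rwa [hVi]) hVn.1
          refine ⟨G, hG, fun g hg h hh => ?_⟩
          exact (hGd (g ∘ h) (hM.comp_mem_fixing hg hh)).trans (hGd g hg).symm) F hF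
      refine ⟨G, hG, fun g hg V hV hVi h hh => ?_⟩
      obtain ⟨V', hV', hVV'⟩ := hsr V ⟨hV, hVi⟩
      have hFGg := hM.comp_mem_fixing hF (hM.comp_mem_fixing (fixing_anti hni hG)
        (fixing_anti hni hg))
      have hV'n := (hs hV').1
      have hhn := fixing_anti hni hh
      rw [hc _ (hM.comp_mem_fixing hFGg (hM.comp_mem_fixing hhn hV)) _
          (hM.comp_mem_fixing hFGg (hM.comp_mem_fixing hhn hV'n))
          ((hVV'.comp_left h).comp_left _), hGs g hg V' hV' h hh,
        hc _ (hM.comp_mem_fixing hFGg hV) _ (hM.comp_mem_fixing hFGg hV'n) (hVV'.comp_left _)])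
    -- Level `n + k` can be lowered without changing the colour, since `K` ignores the factor split
    -- off by the decomposition.
    have hred : ∀ F ∈ fixing M n, ∀ b, (∀ i < n + k, lev F i < b) → b ≤ lev F (n + k) →
        ∃ G ∈ fixing M n, lev G (n + k) = b ∧ Agree (n + k) G F ∧ c (K ∘ F) = c (K ∘ G) := by
      intro F hF b hb hbF
      obtain ⟨G, hG, L, hL, hGb, -, hLG, hGF⟩ := hM.exists_decomposition hF.1 hbF hb
      have hGn := mem_fixing_of_agree hG (hGF.mono (by omega)) hF
      have hnb : n ≤ b := by have := hM.le_lev hG (n + k); omega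
      refine ⟨G, hGn, hGb, hGF, ?_⟩
      refine Eq.trans ?_ (hKc b hnb id (hM.id_mem_fixing b) G hGn hGb L hL)
      exact hc _ (hM.comp_mem_fixing hK hF) _
        (hM.comp_mem_fixing hK (hM.comp_mem_fixing (fixing_anti hnb hL) hGn))
        (hLG.symm.comp_left K)
    obtain ⟨F, hF, d, hFd⟩ := ih (fun g => c (K ∘ g)) fun F hF F' hF' hFF' => by
      -- At the lowest admissible `b`, `agree_succ` leaves no freedom on level `n + k`.
      have hlow : ∃ b, (∀ i < n + k, lev F i < b) ∧ ∀ j, (∀ i < n + k, lev F i < j) → b ≤ j := by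
        classical
        have hex : ∃ b, ∀ i < n + k, lev F i < b :=
          ⟨lev F (n + k), fun i hi => hM.lev_strictMono hF.1 hi⟩
        exact ⟨Nat.find hex, Nat.find_spec hex, fun j hj => Nat.find_min' hex hj⟩
      obtain ⟨b, hb, hbmin⟩ := hlow
      have hlev : ∀ i < n + k, lev F i = lev F' i := fun i hi =>
        hM.lev_congr hF.1 hF'.1 hFF' hi
      obtain ⟨G, hG, hGb, hGF, hcG⟩ := hred F hF b hb
        (hbmin _ fun i hi => hM.lev_strictMono hF.1 hi)
      obtain ⟨G', hG', hG'b, hG'F, hcG'⟩ := hred F' hF' b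
        (fun i hi => by rw [← hlev i hi]; exact hb i hi)
        (hbmin _ fun i hi => by rw [hlev i hi]; exact hM.lev_strictMono hF'.1 hi)
      show c (K ∘ F) = c (K ∘ F')
      rw [hcG, hcG']
      refine hc _ (hM.comp_mem_fixing hK hG) _ (hM.comp_mem_fixing hK hG') (Agree.comp_left ?_ K)
      refine hM.agree_succ (m := n + k) hG.1 hG'.1 ((hGF.trans hFF').trans hG'F.symm) (fun j hj => ?_)
        (by rw [hGb, hG'b])
      rw [hGb]
      exact hbmin j fun i hi => by
        rw [← hM.lev_congr hG.1 hF.1 hGF hi]; exact hj i hi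
    exact ⟨K ∘ F, hM.comp_mem_fixing hK hF, d, hFd⟩

end IsSMTree
end ShapeRamsey

open ShapeRamsey in
theorem theorem1p4 {T : Type u} [PartialOrder T] {A : Type v}
    (S : STree T A) (M : Set (T → T)) (hM : IsSMTree S M) (n k : ℕ)
    {C : Type w} [Finite C] (χ : approx M n k → C) :
    ∃ (F : T → T) (hF : F ∈ fixing M n), ∃ c : C, ∀ g : approx M n k,
      χ ⟨F ∘ g.1, hM.comp_mem_approx hF g.2⟩ = c := by
  classical
  -- Outside ℳ^n the colour is a dummy value.
  let c : (T → T) → C := fun F =>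
    if hF : F ∈ fixing M n then χ ⟨fun a => F a.1, F, hF, rfl⟩
    else χ ⟨fun a => a.1, id, hM.id_mem_fixing n, rfl⟩
  have hcF : ∀ F (hF : F ∈ fixing M n), c F = χ ⟨fun a => F a.1, F, hF, rfl⟩ :=
    fun F hF => dif_pos hF
  obtain ⟨F, hF, d, hd⟩ := hM.exists_monochromatic k c fun F hF G hG hFG => by
    rw [hcF F hF, hcF G hG]
    exact congrArg χ (Subtype.ext (funext fun a => hFG a.1 a.2))
  refine ⟨F, hF, d, ?_⟩
  rintro ⟨_, G, hG, rfl⟩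
  rw [← hd G hG, hcF _ (hM.comp_mem_fixing hF hG)]
  rfl
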